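/- **Conventions.** All graphs are finite and simple. For a graph $G$ on $n$ vertices, $x\in V(G)$ and $S,T\subseteq V(G)$: $d_S(x)$ is the number of neighbours of $x$ in $S$, $\overline S=V(G)\setminus S$, and $e(S,T)$ is the number of edges with one endpoint in $S$ and the other in $T$. $G$ is *3-connected* if it has more than three vertices and remains connected after deleting any at most two vertices. *Robust expanders.* A graph $H$ on $m$ vertices is a *robust $(\nu,\tau)$-expander* if for every $S\subseteq V(H)$ with $\tau m\le |S|\le(1-\tau)m$ at least $|S|+\nu m$ vertices of $H$ have at least $\nu m$ neighbours in $S$. *Robust partitions.* Let $0<\rho\le\nu\le\tau<1$ and let $G$ be a $D$-regular graph on $n$ vertices. A partition $\mathcal V=\{V_1,\dots,V_4\}$ of $V(G)$ into four nonempty parts is a *robust partition of $G$ with parameters $\rho,\nu,\tau,4,0$* if 1. for every $i$: $|V_i|\ge\sqrt\rho\,n$, $e(V_i,\overline{V_i})\le\rho n^2$, and $G[V_i]$ is a robust $(\nu,\tau)$-expander; 2. $d_X(x)\ge d_{X'}(x)$ for all $X,X'\in\mathcal V$ and all $x\in X$; 3. $4\le\lfloor(1+\rho^{1/3})n/D\rfloor$;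 4. for every $X\in\mathcal V$, all but at most $\rho n$ vertices $x\in X$ satisfy $d_X(x)\ge D-\rho n$. *Tours.* A *path system* $\mathcal P$ in $G$ is a collection of pairwise vertex-disjoint paths of $G$, each with at least one edge; $V(\mathcal P)$ is the set of all vertices on its paths. The *reduced multigraph* $R_{\mathcal V}(\mathcal P)$ has vertex set $\mathcal V$ and, for every path in $\mathcal P$, one edge joining the parts that contain its two endpoints (loops and multiple edges are allowed). An *Euler tour* of a multigraph is a closed walk that uses every edge exactly once and visits every vertex. $\mathcal P$ is a *$\mathcal V$-tour with parameter $\gamma$* if $R_{\mathcal V}(\mathcal P)$ has an Euler tour and $|V(\mathcal P)\cap X|\le\gamma n$ for all $X\in\mathcal V$. **Lemma 5.1.** There is a non-decreasing function $f:(0,1]\to(0,1]$ such that the following holds for all positive integers $D,n$ and all $\rho,\nu,\tau\in(0,1]$ with $1/n\le f(\rho)$, $\rho\le f(\nu)$, $\nu\le f(\tau)$ and $\tau\le f(1)$. Let $G$ be a 3-connected $D$-regular graph on $n$ vertices with $D\ge n/4$, and let $\mathcal V$ be a robust partition of $G$ with parameters $\rho,\nu,\tau,4,0$. Then $G$ contains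 a $\mathcal V$-tour with parameter $33/n$. -/

import Mathlib

namespace RegularHam

universe u

/-! ### Degrees, edges, connectivity -/

/-- `d_Y(x)`: the number of neighbours of `x` in `Y`. -/
noncomputable def degIn {V : Type u} (G : SimpleGraph V) (Y : Set V) (x : V) : ℕ :=
  (G.neighborSet x ∩ Y).ncard

/-- `e_G(S, T)`: the number of edges of `G` with one endpoint in `S` and the other in `T`
(the sets need not be disjoint, and each edge is counted once). -/
noncomputable def edgesBetween {V : Type u} (G : SimpleGraph V) (S T : Set V) : ℕ :=
  {e : Sym2 V | e ∈ G.edgeSet ∧ ∃ s ∈ S, ∃ t ∈ T, e = s(s, t)}.ncard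

/-- `k`-connectivity of a finite graph: more than `k` vertices, and deleting fewer than `k`
vertices never disconnects the graph. -/
def IsKConnected {V : Type u} (G : SimpleGraph V) (k : ℕ) : Prop :=
  k < Nat.card V ∧ ∀ S : Set V, S.ncard < k → (G.induce Sᶜ).Connected

/-! ### Robust expanders -/

/-- The `ν`-robust neighbourhood of `S`: all vertices with at least `ν n` neighbours in `S`,
where `n` is the order of `H`. -/
def robustNbhd {W : Type u} (H : SimpleGraph W) (ν : ℝ) (S : Set W) : Set W :=
  {x | ν * Nat.card W ≤ degIn H S x}

/-- `H` is a robust `(ν, τ)`-expander. -/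
def IsRobustExpander {W : Type u} (H : SimpleGraph W) (ν τ : ℝ) : Prop :=
  ∀ S : Set W, τ * Nat.card W ≤ S.ncard → (S.ncard : ℝ) ≤ (1 - τ) * Nat.card W →
    (S.ncard : ℝ) + ν * Nat.card W ≤ (robustNbhd H ν S).ncard

/-- `H` is a bipartite robust `(ν, τ)`-expander with bipartition `A, B`
(`H` itself need not be bipartite, and the order of `A`, `B` matters). -/
def IsBipRobustExpander {W : Type u} (H : SimpleGraph W) (A B : Set W) (ν τ : ℝ) : Prop :=
  Disjoint A B ∧ A ∪ B = Set.univ ∧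
  ∀ S : Set W, S ⊆ A → τ * A.ncard ≤ S.ncard → (S.ncard : ℝ) ≤ (1 - τ) * A.ncard →
    (S.ncard : ℝ) + ν * Nat.card W ≤ (robustNbhd H ν S ∩ B).ncard

/-- `U` is a `ρ`-component of `G`. -/
def IsRhoComponent {V : Type u} (G : SimpleGraph V) (U : Set V) (ρ : ℝ) : Prop :=
  √ρ * Nat.card V ≤ U.ncard ∧ (edgesBetween G U Uᶜ : ℝ) ≤ ρ * (Nat.card V : ℝ) ^ 2

/-- `G[U]` is `ρ`-close to bipartite with bipartition `U₁, U₂`. -/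
def IsCloseToBipartite {V : Type u} (G : SimpleGraph V) (U U₁ U₂ : Set V) (ρ : ℝ) : Prop :=
  U₁ ∪ U₂ = U ∧ Disjoint U₁ U₂ ∧
  √ρ * Nat.card V ≤ U₁.ncard ∧ √ρ * Nat.card V ≤ U₂.ncard ∧
  |(U₁.ncard : ℝ) - U₂.ncard| ≤ ρ * Nat.card V ∧
  (edgesBetween G U₁ U₂ᶜ : ℝ) + edgesBetween G U₂ U₁ᶜ ≤ ρ * (Nat.card V : ℝ) ^ 2

/-- `G[U]` is a `(ρ, ν, τ)`-robust expander component of `G`. -/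
def IsRobustExpanderComponent {V : Type u} (G : SimpleGraph V) (U : Set V) (ρ ν τ : ℝ) : Prop :=
  IsRhoComponent G U ρ ∧ IsRobustExpander (G.induce U) ν τ

/-- `G[U]` is a bipartite `(ρ, ν, τ)`-robust expander component of `G` with
bipartition `A, B`. -/
def IsBipRobustExpanderComponent {V : Type u} (G : SimpleGraph V) (U A B : Set V)
    (ρ ν τ : ℝ) : Prop :=
  IsCloseToBipartite G U A B ρ ∧
  IsBipRobustExpander (G.induce U) (Subtype.val ⁻¹' A) (Subtype.val ⁻¹' B) ν τ

/-! ### Robust partitions -/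

/-- A partition `V_1, …, V_k, W_1, …, W_ℓ` of the vertex set into nonempty parts, given by
the map that sends a vertex to the label of its part (`Sum.inl i` for `V_i`, `Sum.inr j` for
`W_j`), together with a partition `A_j, B_j` of each `W_j`. -/
structure VertexPartition (V : Type u) (k ℓ : ℕ) where
  cls : V → Fin k ⊕ Fin ℓ
  cls_surjective : Function.Surjective cls
  A : Fin ℓ → Set V
  B : Fin ℓ → Set V
  disjoint_AB : ∀ j, Disjoint (A j) (B j)
  union_AB : ∀ j, A j ∪ B j = cls ⁻¹' {Sum.inr j}

/-- The part with label `i`. -/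
def VertexPartition.part {V : Type u} {k ℓ : ℕ} (𝒱 : VertexPartition V k ℓ)
    (i : Fin k ⊕ Fin ℓ) : Set V :=
  𝒱.cls ⁻¹' {i}

/-- `𝒱` is a robust partition of the `D`-regular graph `G` with parameters
`ρ, ν, τ, k, ℓ`. -/
structure IsRobustPartition {V : Type u} {k ℓ : ℕ} (G : SimpleGraph V) (D : ℕ)
    (𝒱 : VertexPartition V k ℓ) (ρ ν τ : ℝ) : Prop where
  rho_pos : 0 < ρ
  rho_le_nu : ρ ≤ ν
  nu_le_tau : ν ≤ τ
  tau_lt_one : τ < 1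
  expander : ∀ i : Fin k, IsRobustExpanderComponent G (𝒱.part (Sum.inl i)) ρ ν τ
  bipExpander : ∀ j : Fin ℓ,
    IsBipRobustExpanderComponent G (𝒱.part (Sum.inr j)) (𝒱.A j) (𝒱.B j) ρ ν τ
  degree_own_part : ∀ i i' : Fin k ⊕ Fin ℓ, ∀ x ∈ 𝒱.part i,
    degIn G (𝒱.part i') x ≤ degIn G (𝒱.part i) x
  degree_A : ∀ j : Fin ℓ, ∀ u ∈ 𝒱.A j, degIn G (𝒱.A j) u ≤ degIn G (𝒱.B j) u
  degree_B : ∀ j : Fin ℓ, ∀ v ∈ 𝒱.B j, degIn G (𝒱.B j) v ≤ degIn G (𝒱.A j) v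
  number_of_parts : k + 2 * ℓ ≤ ⌊(1 + ρ ^ (1 / 3 : ℝ)) * Nat.card V / D⌋₊
  degree_most : ∀ i : Fin k ⊕ Fin ℓ,
    ({x ∈ 𝒱.part i | (degIn G (𝒱.part i) x : ℝ) < D - ρ * Nat.card V}.ncard : ℝ)
      ≤ ρ * Nat.card V

/-! ### Path systems, reduced multigraphs and tours -/

/-- A path system in `G`: finitely many pairwise vertex-disjoint nontrivial paths of `G`.
(Each path is listed in one of its two directions, which plays no role below.) -/
structure PathSystem {V : Type u} (G : SimpleGraph V) where
  size : ℕ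
  src : Fin size → V
  tgt : Fin size → V
  walk : ∀ i, G.Walk (src i) (tgt i)
  isPath : ∀ i, (walk i).IsPath
  nontrivial : ∀ i, 0 < (walk i).length
  disjoint : ∀ i j, i ≠ j → ∀ x, x ∈ (walk i).support → x ∉ (walk j).support

/-- The set `V(𝒫)` of all vertices on the paths of `𝒫`. -/
def PathSystem.verts {V : Type u} {G : SimpleGraph V} (P : PathSystem G) : Set V :=
  {x | ∃ i, x ∈ (P.walk i).support}

/-- The set of endpoints of the paths of `𝒫`. -/
def PathSystem.endpoints {V : Type u} {G : SimpleGraph V} (P : PathSystem G) : Set V :=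
  Set.range P.src ∪ Set.range P.tgt

/-- The reduced multigraph `R_𝒱(𝒫)`: its vertices are the (labels of the) parts of `𝒱`, and
each path of `𝒫` gives one edge, joining the parts that contain its two endpoints. Loops and
multiple edges are allowed. -/
def reducedMultigraph {V : Type u} {k ℓ : ℕ} {G : SimpleGraph V}
    (𝒱 : VertexPartition V k ℓ) (P : PathSystem G) : Graph (Fin k ⊕ Fin ℓ) (Fin P.size) where
  vertexSet := Set.univ
  IsLink p X Y := s(𝒱.cls (P.src p), 𝒱.cls (P.tgt p)) = s(X, Y)
  isLink_symm := fun _ _ => ⟨fun _ _ h => h.trans Sym2.eq_swap⟩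
  eq_or_eq_of_isLink_of_isLink := by
    intro e x y v w h h'
    have h2 := h.symm.trans h'
    rw [Sym2.eq_iff] at h2
    rcases h2 with h2 | h2
    · exact Or.inl h2.1
    · exact Or.inr h2.1
  left_mem_of_isLink := fun _ _ _ _ => Set.mem_univ _

/-- The multigraph `R` has an Euler tour: a closed walk `x 0, e 0, x 1, …, e (m-1), x m = x 0`
that uses each edge of `R` exactly once and visits every vertex of `R`. -/
def HasEulerTour {α β : Type*} (R : Graph α β) : Prop :=
  ∃ (m : ℕ) (x : Fin (m + 1) → α) (e : Fin m → β),
    x 0 = x (Fin.last m) ∧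
    (∀ i : Fin m, R.IsLink (e i) (x i.castSucc) (x i.succ)) ∧
    Function.Injective e ∧ Set.range e = R.edgeSet ∧ Set.range x = R.vertexSet

/-- `𝒫` is a `𝒱`-tour with parameter `γ`. -/
structure IsTour {V : Type u} {k ℓ : ℕ} {G : SimpleGraph V} (𝒱 : VertexPartition V k ℓ)
    (P : PathSystem G) (γ : ℝ) : Prop where
  eulerTour : HasEulerTour (reducedMultigraph 𝒱 P)
  few_vertices : ∀ i : Fin k ⊕ Fin ℓ,
    ((P.verts ∩ 𝒱.part i).ncard : ℝ) ≤ γ * Nat.card V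
  balanced : ∀ j : Fin ℓ, (𝒱.A j \ P.verts).ncard = (𝒱.B j \ P.verts).ncard
  balanced_endpoints : ∀ j : Fin ℓ,
    (P.endpoints ∩ 𝒱.A j).ncard = (P.endpoints ∩ 𝒱.B j).ncard ∧
      0 < (P.endpoints ∩ 𝒱.A j).ncard

end RegularHam

namespace RegularHam

open SimpleGraph

/-! ### Menger's theorem -/

section Menger

variable {V : Type*}

/-! A tour amounts to a closed sequence of disjoint paths, each starting in the class where the
previous one ends, that visits all four classes. By Menger's theorem
(`hasDisjointWalks_of_separates`), 3-connectedness joins any two sets of at least three vertices by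
three disjoint paths. This gives a closed sequence through three classes a, c, d
(`exists_triangle`): of three paths from d to the union of two disjoint a–c paths, two end on the
same one, which can then be detoured through d.

Inserting the fourth class b into this triangle of three paths by pigeonhole takes four disjoint
paths from b (`exists_hasTrailIn`), more than 3-connectedness provides. They exist for a suitable
pair a, b (`exists_linked_pair`). Otherwise any two classes are separated by three vertices, so at
most 48 vertices meet every edge between different classes. This contradicts regularity with n ≤ 4D
(`le_of_cover`): a vertex outside the cover has all its neighbours in its own class or in the cover,
the classes have at most D vertices on average, and so too many edges would enter the cover.

The paths may be long, but each can be cut into a trail with at most two vertices in every class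
(`exists_short_trail`). At most five paths are used, which leaves at most 10 vertices per class. -/

/-- There are `k` pairwise vertex-disjoint walks of `G` from `A` to `B`. -/
def HasDisjointWalks (G : SimpleGraph V) (A B : Set V) (k : ℕ) : Prop :=
  ∃ (x y : Fin k → V) (p : ∀ i, G.Walk (x i) (y i)),
    (∀ i, x i ∈ A) ∧ (∀ i, y i ∈ B) ∧
      ∀ i j, i ≠ j → ∀ z, z ∈ (p i).support → z ∉ (p j).support

/-- Every walk of `G` from `A` to `B` meets `S`. -/
def Separates (G : SimpleGraph V) (A B : Set V) (S : Finset V) : Prop :=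
  ∀ a ∈ A, ∀ b ∈ B, ∀ p : G.Walk a b, ∃ z ∈ p.support, z ∈ S

lemma Separates.symm {G : SimpleGraph V} {A B : Set V} {S : Finset V} (h : Separates G A B S) :
    Separates G B A S := by
  intro b hb a ha p
  obtain ⟨z, hz, hzS⟩ := h a ha b hb p.reverse
  exact ⟨z, by simpa using hz, hzS⟩

/-- The walks may be chosen independently, since the disjoint sets `U s` confine them. -/
lemma hasDisjointWalks_of_finset {G : SimpleGraph V} {A B : Set V} {k : ℕ} (T : Finset V)
    (hT : T.card = k)
    (U : V → Set V)
    (hU : ∀ s ∈ T, ∃ a ∈ A, ∃ b ∈ B, ∃ p : G.Walk a b, ∀ z ∈ p.support, z ∈ U s)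
    (hdisj : ∀ s ∈ T, ∀ t ∈ T, s ≠ t → Disjoint (U s) (U t)) :
    HasDisjointWalks G A B k := by
  choose! a ha b hb p hp using hU
  let e := (T.equivFinOfCardEq hT).symm
  refine ⟨fun i => a (e i), fun i => b (e i), fun i => p (e i) (e i).2,
    fun i => ha _ (e i).2, fun i => hb _ (e i).2, fun i j hij z hz hz' => ?_⟩
  have hne : (e i : V) ≠ e j := fun h => hij (e.injective (Subtype.ext h))
  exact Set.disjoint_left.1 (hdisj _ (e i).2 _ (e j).2 hne) (hp _ (e i).2 z hz)
    (hp _ (e j).2 z hz')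

/-- A family of `|T|` disjoint walks from `A` to `T` can be indexed by `T`. -/
lemma HasDisjointWalks.exists_index {G : SimpleGraph V} {A : Set V} (T : Finset V)
    (h : HasDisjointWalks G A T T.card) :
    ∃ (a : V → V) (p : ∀ s, G.Walk (a s) s), (∀ s ∈ T, a s ∈ A) ∧ (∀ s, (p s).IsPath) ∧
      ∀ s ∈ T, ∀ t ∈ T, s ≠ t → ∀ z, z ∈ (p s).support → z ∉ (p t).support := by
  classical
  obtain ⟨x, y, p, hx, hy, hp⟩ := h
  have hinj : Function.Injective y := by
    intro i j hij
    by_contra hne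
    exact hp i j hne (y i) (p i).end_mem_support (by rw [hij]; exact (p j).end_mem_support)
  have hsurj : ∀ s ∈ T, ∃ i, y i = s := by
    have himg : Finset.univ.image y = T := by
      apply Finset.eq_of_subset_of_card_le
      · intro z hz
        obtain ⟨i, -, rfl⟩ := Finset.mem_image.1 hz
        exact hy i
      · rw [Finset.card_image_of_injective _ hinj]; simp
    intro s hs
    rw [← himg] at hs
    simpa using hs
  have key : ∀ s, ∃ a, ∃ q : G.Walk a s, q.IsPath ∧
      (s ∈ T → a ∈ A ∧ ∃ i, y i = s ∧ ∀ z ∈ q.support, z ∈ (p i).support) := by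
    intro s
    by_cases hs : s ∈ T
    · obtain ⟨i, rfl⟩ := hsurj s hs
      exact ⟨x i, (p i).bypass, (p i).bypass_isPath, fun _ => ⟨hx i, i, rfl,
        fun z hz => (p i).support_bypass_subset_support hz⟩⟩
    -- A dummy value outside `T`, so that the family is total.
    · exact ⟨s, Walk.nil, by simp, fun h => absurd h hs⟩
  choose a q hq hqT using key
  refine ⟨a, q, fun s hs => (hqT s hs).1, hq, fun s hs t ht hst z hz hz' => ?_⟩
  obtain ⟨-, i, hi, hi'⟩ := hqT s hs
  obtain ⟨-, j, hj, hj'⟩ := hqT t ht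
  have hij : i ≠ j := by rintro rfl; exact hst (hi.symm.trans hj)
  exact hp i j hij z (hi' z hz) (hj' z hz')

/-- The part of a walk up to its first vertex in `T`. -/
lemma exists_first_hit {G : SimpleGraph V} (T : Set V) {a b : V} (p : G.Walk a b)
    (h : ∃ z ∈ p.support, z ∈ T) :
    ∃ z ∈ T, ∃ q : G.Walk a z, q.IsPath ∧ (∀ w ∈ q.support, w ∈ p.support) ∧
      ∀ w ∈ q.support, w ∈ T → w = z := by
  classical
  have key : ∃ z ∈ T, ∃ q : G.Walk a z, (∀ w ∈ q.support, w ∈ p.support) ∧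
      ∀ w ∈ q.support, w ∈ T → w = z := by
    induction p with
    | nil =>
      obtain ⟨z, hz, hzT⟩ := h
      simp only [Walk.support_nil, List.mem_singleton] at hz
      subst hz
      exact ⟨z, hzT, Walk.nil, by simp, by simp⟩
    | @cons u v w huv p ih =>
      by_cases hu : u ∈ T
      · exact ⟨u, hu, Walk.nil, by simp, by simp⟩
      · obtain ⟨z, hz, hzT⟩ := h
        rw [Walk.support_cons, List.mem_cons] at hz
        obtain ⟨z', hz', q, hq, hq'⟩ := ih
          ⟨z, hz.resolve_left (fun h => hu (h ▸ hzT)), hzT⟩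
        refine ⟨z', hz', Walk.cons huv q, ?_, ?_⟩
        · intro w hw
          rw [Walk.support_cons, List.mem_cons] at hw ⊢
          exact hw.imp_right (hq w)
        · intro w hw hwT
          rw [Walk.support_cons, List.mem_cons] at hw
          rcases hw with rfl | hw
          · exact absurd hwT hu
          · exact hq' w hw hwT
  obtain ⟨z, hz, q, h1, h2⟩ := key
  exact ⟨z, hz, q.bypass, q.bypass_isPath, fun w hw => h1 w (q.support_bypass_subset_support hw),
    fun w hw => h2 w (q.support_bypass_subset_support hw)⟩

lemma exists_walk_of_notMem_edges {G H : SimpleGraph V} {x y : V}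
    (hH : ∀ u v, G.Adj u v → s(u, v) ≠ s(x, y) → H.Adj u v) {a b : V} (p : G.Walk a b)
    (hp : s(x, y) ∉ p.edges) : ∃ q : H.Walk a b, q.support = p.support := by
  refine ⟨p.transfer H ?_, p.support_transfer _⟩
  intro e he
  induction e with
  | _ u v => exact hH u v (p.adj_of_mem_edges he) (fun h => hp (h ▸ he))

/-- If `S` separates `A` from `y` in `G - xy`, then every walk of `G` from `A` that meets
`S ∪ {x}` does so along an initial part that is a walk of `G - xy`. -/
lemma exists_walk_to_insert [DecidableEq V] {G H : SimpleGraph V} {x y : V} {A : Set V}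
    {S : Finset V}
    (hH : ∀ u v, G.Adj u v → s(u, v) ≠ s(x, y) → H.Adj u v) (hxy : x ≠ y) (hxS : x ∉ S)
    (hy : Separates H A {y} S) {a b : V} (ha : a ∈ A) (p : G.Walk a b)
    (hp : ∃ z ∈ p.support, z ∈ insert x S) :
    ∃ z ∈ insert x S, ∃ q : H.Walk a z, ∀ w ∈ q.support, w ∈ p.support := by
  obtain ⟨z, hz, q, hqp, hq, hqT⟩ := exists_first_hit (insert x S : Finset V) p (by simpa using hp)
  -- If the initial part used the edge, it would end at `x` with `y` earlier; its part up to `y`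
  -- would then lie in `H` and avoid `S`.
  by_cases he : s(x, y) ∈ q.edges
  · exfalso
    have hx := q.fst_mem_support_of_mem_edges he
    have hys := q.snd_mem_support_of_mem_edges he
    obtain rfl : x = z := hqT x hx (by simp)
    have hx' : x ∉ (q.takeUntil y hys).support :=
      Walk.endpoint_notMem_support_takeUntil hqp hys hxy
    obtain ⟨r, hr⟩ := exists_walk_of_notMem_edges hH (q.takeUntil y hys)
      (fun h => hx' (Walk.fst_mem_support_of_mem_edges _ h))
    obtain ⟨w, hw, hwS⟩ := hy a ha y rfl r
    rw [hr] at hw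
    have := hqT w (q.support_takeUntil_subset_support hys hw) (by simp [hwS])
    exact hxS (this ▸ hwS)
  · obtain ⟨r, hr⟩ := exists_walk_of_notMem_edges hH q he
    exact ⟨z, hz, r, fun w hw => hq w (hr ▸ hw)⟩

/-- An edge of a walk that leaves the set `R`. -/
lemma exists_adj_leaving {G : SimpleGraph V} (R : Set V) {a b : V} (p : G.Walk a b) (ha : a ∈ R)
    (hb : b ∉ R) : ∃ u ∈ p.support, ∃ v ∈ p.support, G.Adj u v ∧ u ∈ R ∧ v ∉ R := by
  obtain ⟨d, hd, h1, h2⟩ := p.exists_boundary_dart R ha hb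
  exact ⟨d.fst, p.dart_fst_mem_support_of_mem_darts hd, d.snd,
    p.dart_snd_mem_support_of_mem_darts hd, d.adj, h1, h2⟩

/-- The path can meet `S` only in its last vertex, and stopping at `z` cuts that vertex off. -/
lemma exists_avoiding_walk {H : SimpleGraph V} {S : Finset V} {a s z : V} (p : H.Walk a s)
    (hp : p.IsPath) (hpS : ∀ w ∈ p.support, w ∈ S → w = s) (hz : z ∈ p.support)
    (hzs : z ∈ S → z ≠ s) : ∃ q : H.Walk a z, ∀ w ∈ q.support, w ∉ S := by
  classical
  refine ⟨p.takeUntil z hz, fun w hw hwS => ?_⟩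
  obtain rfl := hpS w (p.support_takeUntil_subset_support hz hw) hwS
  by_cases h : w = z
  · subst h; exact hzs hwS rfl
  · exact Walk.endpoint_notMem_support_takeUntil hp hz h hw

/-- **Menger's theorem**. -/
theorem hasDisjointWalks_of_separates [Finite V] (G : SimpleGraph V) (A B : Set V) (k : ℕ)
    (h : ∀ S : Finset V, Separates G A B S → k ≤ S.card) : HasDisjointWalks G A B k := by
  classical
  induction G using WellFoundedLT.induction generalizing A B with
  | _ G ih =>
  by_cases hG : ∃ x y, G.Adj x y
  swap
  · push Not at hG
    -- Without edges all walks are trivial, so `A ∩ B` is a separator.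
    have hsep : Separates G A B (A ∩ B).toFinite.toFinset := by
      intro a ha b hb p
      cases p with
      | nil => exact ⟨a, by simp, by simp [ha, hb]⟩
      | cons h _ => exact absurd h (hG _ _)
    obtain ⟨T, hT, hTk⟩ := Finset.exists_subset_card_eq (h _ hsep)
    refine hasDisjointWalks_of_finset T hTk (fun s => {s}) (fun s hs => ?_) (fun s _ t _ hst => by simpa using hst)
    have := hT hs
    simp only [Set.Finite.mem_toFinset] at this
    exact ⟨s, this.1, s, this.2, Walk.nil, by simp⟩
  obtain ⟨x₀, y₀, hadj₀⟩ := hG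
  set H := G.deleteEdges {s(x₀, y₀)} with hHdef
  have hHle : H ≤ G := G.deleteEdges_le _
  have hHlt : H < G := by
    refine lt_of_le_of_ne hHle (fun heq => ?_)
    have : H.Adj x₀ y₀ := heq ▸ hadj₀
    simp [hHdef] at this
  have lift : ∀ {A' B' : Set V}, HasDisjointWalks H A' B' k → HasDisjointWalks G A' B' k := by
    rintro A' B' ⟨x, y, p, hx, hy, hp⟩
    exact ⟨x, y, fun i => (p i).mapLe hHle, hx, hy, fun i j hij z => by simpa using hp i j hij z⟩
  by_cases hS : ∀ S : Finset V, Separates H A B S → k ≤ S.card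
  · exact lift (ih H hHlt A B hS)
  push Not at hS
  obtain ⟨S, hSsep, hSk⟩ := hS
  have hSG : ¬ Separates G A B S := fun h' => absurd (h S h') (by omega)
  simp only [Separates] at hSG
  push Not at hSG
  obtain ⟨a, ha, b, hb, p, hpS⟩ := hSG
  -- A walk of `G` that avoids `S` must leave `R`, and it can do so only over the deleted edge. This
  -- orients that edge as `x`, `y`.
  let R : Set V := {v | ∃ a ∈ A, ∃ q : H.Walk a v, ∀ w ∈ q.support, w ∉ S}
  have haR : a ∈ R := ⟨a, ha, Walk.nil, by simpa using hpS a p.start_mem_support⟩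
  have hbR : b ∉ R := by
    rintro ⟨a', ha', q, hq⟩
    obtain ⟨z, hz, hzS⟩ := hSsep a' ha' b hb q
    exact hq z hz hzS
  obtain ⟨x, hxp, y, hyp, hxy, hxR, hyR⟩ := exists_adj_leaving R p haR hbR
  have hxS := hpS x hxp
  have hyS := hpS y hyp
  have hxyne : x ≠ y := hxy.ne
  have he : s(x, y) = s(x₀, y₀) := by
    by_contra hne
    apply hyR
    obtain ⟨a', ha', q, hq⟩ := hxR
    have hH : H.Adj x y := by simp [hHdef, hxy, hne]
    refine ⟨a', ha', q.concat hH, fun w hw => ?_⟩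
    rw [Walk.support_concat, List.mem_append] at hw
    rcases hw with hw | hw
    · exact hq w hw
    · simp only [List.mem_singleton] at hw
      exact hw ▸ hyS
  have hH : ∀ u v, G.Adj u v → s(u, v) ≠ s(x, y) → H.Adj u v := by
    intro u v huv hne
    rw [he] at hne
    simp [hHdef, huv, hne]
  have hH' : ∀ u v, G.Adj u v → s(u, v) ≠ s(y, x) → H.Adj u v := by
    intro u v huv hne
    exact hH u v huv (by rwa [Sym2.eq_swap (a := x)])
  have hsepy : Separates H A {y} S := by
    rintro a' ha' y' rfl q
    by_contra hcon
    push Not at hcon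
    exact hyR ⟨a', ha', q, hcon⟩
  have hsepx : Separates H B {x} S := by
    rintro b' hb' x' rfl q
    by_contra hcon
    push Not at hcon
    obtain ⟨a', ha', r, hr⟩ := hxR
    obtain ⟨z, hz, hzS⟩ := hSsep a' ha' b' hb' (r.append q.reverse)
    rw [Walk.mem_support_append_iff] at hz
    rcases hz with hz | hz
    · exact hr z hz hzS
    · exact hcon z (by simpa using hz) hzS
  have hsepT : ∀ c, c = x ∨ c = y → Separates G A B (insert c S) := by
    intro c hc a' ha' b' hb' q
    by_cases hq : s(x, y) ∈ q.edges
    · refine ⟨c, ?_, by simp⟩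
      rcases hc with rfl | rfl
      · exact q.fst_mem_support_of_mem_edges hq
      · exact q.snd_mem_support_of_mem_edges hq
    · obtain ⟨r, hr⟩ := exists_walk_of_notMem_edges hH q hq
      obtain ⟨z, hz, hzS⟩ := hSsep a' ha' b' hb' r
      exact ⟨z, hr ▸ hz, by simp [hzS]⟩
  have hcard : ∀ c, c ∉ S → (c = x ∨ c = y) → (insert c S).card = k := by
    intro c hcS hc
    have := h _ (hsepT c hc)
    rw [Finset.card_insert_of_notMem hcS] at this ⊢
    omega
  -- Every walk of `G` from `A` to `B` starts along a walk of `H` to `S ∪ {x}`, so a separator for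
  -- the smaller problem in `H` also separates `A` from `B` in `G`.
  have hA : HasDisjointWalks H A (insert x S : Finset V) k := by
    refine ih H hHlt _ _ (fun S' hS' => h S' ?_)
    intro a' ha' b' hb' q
    obtain ⟨z, hz, r, hr⟩ := exists_walk_to_insert hH hxyne hxS hsepy ha' q
      (hsepT x (Or.inl rfl) a' ha' b' hb' q)
    obtain ⟨w, hw, hwS⟩ := hS' a' ha' z (by exact_mod_cast hz) r
    exact ⟨w, hr w hw, hwS⟩
  have hB : HasDisjointWalks H B (insert y S : Finset V) k := by
    refine ih H hHlt _ _ (fun S' hS' => h S' (Separates.symm ?_))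
    intro b' hb' a' ha' q
    obtain ⟨z, hz, r, hr⟩ := exists_walk_to_insert hH' hxyne.symm hyS hsepx hb' q
      ((hsepT y (Or.inr rfl)).symm b' hb' a' ha' q)
    obtain ⟨w, hw, hwS⟩ := hS' b' hb' z (by exact_mod_cast hz) r
    exact ⟨w, hr w hw, hwS⟩
  rw [← hcard x hxS (Or.inl rfl)] at hA
  rw [← hcard y hyS (Or.inr rfl)] at hB
  obtain ⟨α, P, hαA, hP, hPd⟩ := hA.exists_index
  obtain ⟨β, Q, hβB, hQ, hQd⟩ := hB.exists_index
  have hPS : ∀ s ∈ insert x S, ∀ w ∈ (P s).support, w ∈ S → w = s := by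
    intro s hs w hw hwS
    by_contra hne
    exact hPd s hs w (by simp [hwS]) (Ne.symm hne) w hw (P w).end_mem_support
  have hQS : ∀ s ∈ insert y S, ∀ w ∈ (Q s).support, w ∈ S → w = s := by
    intro s hs w hw hwS
    by_contra hne
    exact hQd s hs w (by simp [hwS]) (Ne.symm hne) w hw (Q w).end_mem_support
  -- A crossing outside `S` would give a walk of `H` from `A` to `B` that avoids `S`.
  have hPQ : ∀ s ∈ insert x S, ∀ t ∈ insert y S, s ≠ t →
      ∀ z ∈ (P s).support, z ∉ (Q t).support := by
    intro s hs t ht hst z hzs hzt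
    by_cases h1 : z ∈ S
    · exact hst ((hPS s hs z hzs h1).symm.trans (hQS t ht z hzt h1))
    · obtain ⟨p1, hp1⟩ := exists_avoiding_walk (P s) (hP s) (hPS s hs) hzs (fun h => absurd h h1)
      obtain ⟨p2, hp2⟩ := exists_avoiding_walk (Q t) (hQ t) (hQS t ht) hzt (fun h => absurd h h1)
      obtain ⟨w, hw, hwS⟩ := hSsep _ (hαA s hs) _ (hβB t ht) (p1.append p2.reverse)
      rw [Walk.mem_support_append_iff] at hw
      rcases hw with hw | hw
      · exact hp1 w hw hwS
      · exact hp2 w (by simpa using hw) hwS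
  -- The path ending at `x` continues over the edge to `y`; every other path is glued at its own end
  -- in `S`.
  let σ : V → V := fun s => if s = x then y else s
  have hσ : ∀ s ∈ insert x S, σ s ∈ insert y S := by
    intro s hs
    simp only [σ]
    split_ifs with hsx
    · simp
    · simp only [Finset.mem_insert] at hs ⊢
      exact Or.inr (hs.resolve_left hsx)
  have hσne : ∀ s ∈ insert x S, ∀ t ∈ insert x S, s ≠ t → s ≠ σ t := by
    intro s hs t ht hst
    simp only [σ]
    split_ifs with htx
    · rintro rfl
      simp only [Finset.mem_insert] at hs
      exact hs.elim (fun h => hxyne h.symm) hyS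
    · exact hst
  have hσσ : ∀ s ∈ insert x S, ∀ t ∈ insert x S, s ≠ t → σ s ≠ σ t := by
    intro s hs t ht hst heq
    by_cases hsx : s = x
    · have : σ s = y := by simp [σ, hsx]
      rw [this] at heq
      have htx : t ≠ x := fun h => hst (hsx.trans h.symm)
      have : σ t = t := by simp [σ, htx]
      rw [this] at heq
      simp only [Finset.mem_insert] at ht
      exact hyS (heq ▸ ht.resolve_left htx)
    · have : σ s = s := by simp [σ, hsx]
      rw [this] at heq
      exact hσne s hs t ht hst heq
  refine hasDisjointWalks_of_finset (insert x S) (hcard x hxS (Or.inl rfl))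
    (fun s => {z | z ∈ (P s).support ∨ z ∈ (Q (σ s)).support}) (fun s hs => ?_)
    (fun s hs t ht hst => ?_)
  · refine ⟨α s, hαA s hs, β (σ s), hβB _ (hσ s hs), ?_⟩
    have hstep : ∃ r : G.Walk s (σ s), ∀ z ∈ r.support, z = s ∨ z = σ s := by
      by_cases hsx : s = x
      · subst hsx
        have : σ s = y := by simp [σ]
        rw [this]
        exact ⟨hxy.toWalk, by simp⟩
      · have : σ s = s := by simp [σ, hsx]
        rw [this]
        exact ⟨Walk.nil, by simp⟩
    obtain ⟨r, hr⟩ := hstep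
    refine ⟨(((P s).mapLe hHle).append r).append ((Q (σ s)).mapLe hHle).reverse, fun z hz => ?_⟩
    simp only [Walk.mem_support_append_iff, Walk.support_reverse, List.mem_reverse,
      Walk.support_mapLe_eq_support] at hz
    rcases hz with (hz | hz) | hz
    · exact Or.inl hz
    · rcases hr z hz with rfl | rfl
      · exact Or.inl (P z).end_mem_support
      · exact Or.inr (Q _).end_mem_support
    · exact Or.inr hz
  · rw [Set.disjoint_left]
    rintro z (hz | hz) (hz' | hz')
    · exact hPd s hs t ht hst z hz hz'
    · exact hPQ s hs _ (hσ t ht) (hσne s hs t ht hst) z hz hz'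
    · exact hPQ t ht _ (hσ s hs) (hσne t ht s hs hst.symm) z hz' hz
    · exact hQd _ (hσ s hs) _ (hσ t ht) (hσσ s hs t ht hst) z hz hz'

end Menger

/-! ### Trails of paths through the classes of a partition -/

section Trails

variable {V α : Type*}

/-- `L` lists the vertex sequences of nontrivial walks of `G`, each starting in the class where
the previous one ends; they lead from class `a` to class `b` and visit the set `W` of classes. -/
inductive Trail (G : SimpleGraph V) (cls : V → α) : α → α → Set α → List (List V) → Prop
  | nil (a : α) : Trail G cls a a {a} []
  | cons {u v : V} (p : G.Walk u v) (hp : 0 < p.length) {b : α} {W : Set α}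
      {L : List (List V)} (h : Trail G cls (cls v) b W L) :
      Trail G cls (cls u) b (insert (cls u) W) (p.support :: L)

variable {G : SimpleGraph V} {cls : V → α}

lemma Trail.start_mem {a b : α} {W : Set α} {L : List (List V)} (h : Trail G cls a b W L) :
    a ∈ W := by
  cases h <;> simp

lemma Trail.end_mem {a b : α} {W : Set α} {L : List (List V)} (h : Trail G cls a b W L) :
    b ∈ W := by
  induction h with
  | nil a => simp
  | cons p hp h ih => exact Set.mem_insert_of_mem _ ih

lemma Trail.append {a b c : α} {W W' : Set α} {L L' : List (List V)} (h : Trail G cls a b W L)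
    (h' : Trail G cls b c W' L') : Trail G cls a c (W ∪ W') (L ++ L') := by
  induction h with
  | nil a => rw [Set.union_eq_right.2 (by simpa using h'.start_mem)]; exact h'
  | cons p hp h ih => rw [Set.insert_union]; exact Trail.cons p hp (ih h')

/-- The part of a walk from its last vertex in class `c` on. -/
lemma exists_suffix_from_last {s t : V} (p : G.Walk s t) (c : α)
    (h : ∃ z ∈ p.support, cls z = c) :
    ∃ v, ∃ r : G.Walk v t, cls v = c ∧ r.support <:+ p.support ∧
      ∀ z ∈ r.support.tail, cls z ≠ c := by
  induction p with
  | nil =>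
    obtain ⟨z, hz, rfl⟩ := h
    simp only [Walk.support_nil, List.mem_singleton] at hz
    subst hz
    exact ⟨_, Walk.nil, rfl, List.suffix_rfl, by simp⟩
  | @cons u v w huv p ih =>
    by_cases hp : ∃ z ∈ p.support, cls z = c
    · obtain ⟨v', r, h1, h2, h3⟩ := ih hp
      refine ⟨v', r, h1, h2.trans ?_, h3⟩
      rw [Walk.support_cons]
      exact List.suffix_cons _ _
    · push Not at hp
      obtain ⟨z, hz, rfl⟩ := h
      rw [Walk.support_cons, List.mem_cons] at hz
      rcases hz with rfl | hz
      · exact ⟨z, Walk.cons huv p, rfl, List.suffix_rfl, by simpa using hp⟩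
      · exact absurd rfl (hp z hz)

/-- A path contains a trail between the same classes that has at most two vertices in every
class. -/
lemma exists_short_trail [DecidableEq α] {s t : V} (p : G.Walk s t) (hp : p.IsPath) :
    ∃ W L, Trail G cls (cls s) (cls t) W L ∧ L.flatten.Sublist p.support ∧
      L.flatten.countP (cls · = cls s) ≤ 1 ∧ ∀ c, L.flatten.countP (cls · = c) ≤ 2 := by
  induction hn : p.length using Nat.strong_induction_on generalizing s with
  | _ n ih =>
  -- Jumping to the last vertex of the starting class is allowed because consecutive walks of a
  -- trail need only share a class. The rest of the path never returns to that class.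
  obtain ⟨v, r, hv, hr, hrt⟩ := exists_suffix_from_last (cls := cls) p (cls s)
    ⟨s, p.start_mem_support, rfl⟩
  have hrp : r.IsPath := by
    rw [Walk.isPath_def] at hp ⊢
    exact hr.sublist.nodup hp
  have hlen : r.length ≤ p.length := by
    have := hr.length_le
    simpa using this
  cases r with
  | nil => exact ⟨_, [], by rw [hv]; exact Trail.nil _, by simp, by simp, by simp⟩
  | @cons _ u _ huv r =>
    -- The sharper bound 1 for the starting class leaves room for one more vertex `u` of that class.
    obtain ⟨W, L, hL, hsub, h1, h2⟩ := ih r.length (by simp at hlen; omega) r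
      ((Walk.cons_isPath_iff _ _).1 hrp).1 rfl
    simp only [Walk.support_cons, List.tail_cons] at hrt
    have hcu : cls u ≠ cls v := fun h => hrt u r.start_mem_support (h.trans hv)
    have hzero : L.flatten.countP (cls · = cls v) = 0 := by
      rw [List.countP_eq_zero]
      intro z hz
      simpa using fun h => hrt z (hsub.subset hz) (h.trans hv)
    rw [Walk.support_cons] at hr
    have fin : ∀ W' L', Trail G cls (cls v) (cls t) W' L' →
        L'.flatten.Sublist (v :: r.support) →
        (L'.flatten = v :: L.flatten ∨ L'.flatten = v :: u :: L.flatten) →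
        ∃ W L, Trail G cls (cls s) (cls t) W L ∧ L.flatten.Sublist p.support ∧
        L.flatten.countP (cls · = cls s) ≤ 1 ∧ ∀ c, L.flatten.countP (cls · = c) ≤ 2 := by
      intro W' L' hT hs hLL
      refine ⟨W', L', hv ▸ hT, hs.trans hr.sublist, ?_, fun c => ?_⟩
      · rw [← hv]
        rcases hLL with h | h <;> rw [h] <;> simp [-List.countP_flatten, hzero, hcu]
      · by_cases hcv : c = cls v
        · subst hcv
          rcases hLL with h | h <;> rw [h] <;> simp [-List.countP_flatten, hzero, hcu]
        · by_cases hc : c = cls u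
          · subst hc
            rcases hLL with h | h <;> rw [h] <;> simp [-List.countP_flatten, hcu.symm] <;> omega
          · have := h2 c
            rcases hLL with h | h <;> rw [h] <;>
              simpa [-List.countP_flatten, Ne.symm hc, Ne.symm hcv] using this
    have extend : L.flatten.Sublist r.support.tail →
        ∃ W L, Trail G cls (cls s) (cls t) W L ∧ L.flatten.Sublist p.support ∧
        L.flatten.countP (cls · = cls s) ≤ 1 ∧ ∀ c, L.flatten.countP (cls · = c) ≤ 2 := by
      intro hs
      refine fin _ ((huv.toWalk).support :: L) (Trail.cons huv.toWalk (by simp) hL) ?_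
        (Or.inr (by simp))
      have hs' := hs.cons_cons u
      rw [r.cons_tail_support] at hs'
      simpa using hs'.cons_cons v
    -- If the shorter trail does not start at the vertex `u`, the edge `vu` becomes a walk of its
    -- own. Otherwise that would repeat `u`, so the edge is merged into the first walk.
    have hsub' := hsub
    rw [← r.cons_tail_support, List.sublist_cons_iff] at hsub'
    rcases hsub' with hs | ⟨l, hl, -⟩
    · exact extend hs
    · cases L with
      | nil => simp at hl
      | cons q L =>
        generalize hcu' : cls u = cu at hL
        cases hL with
        | @cons u' v' q hq _ W L hT =>
        have hu' : u' = u := by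
          have : ((q.support :: L).flatten).head? = some u := by rw [hl]; rfl
          rw [List.flatten_cons, ← q.cons_tail_support] at this
          exact Option.some_injective _ this
        subst hu'
        refine fin _ ((Walk.cons huv q).support :: L)
          (Trail.cons (Walk.cons huv q) (by simp) hT) ?_ (Or.inl (by simp))
        simpa using hsub

/-- `T` contains disjoint paths that form a trail from class `a` to class `b` visiting at least
the classes in `W`, with at most `m` vertices in every class. -/
def HasTrailIn (G : SimpleGraph V) (cls : V → α) (a b : α) (W : Set α) (T : Set V) (m : ℕ) :
    Prop :=
  ∃ W' L, Trail G cls a b W' L ∧ W ⊆ W' ∧ L.flatten.Nodup ∧ (∀ z ∈ L.flatten, z ∈ T) ∧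
    ∀ c, {z | z ∈ L.flatten ∧ cls z = c}.ncard ≤ m

lemma HasTrailIn.append [Finite V] {a b c : α} {W W' : Set α} {T T' : Set V} {m m' : ℕ}
    (h : HasTrailIn G cls a b W T m) (h' : HasTrailIn G cls b c W' T' m') (hT : Disjoint T T') :
    HasTrailIn G cls a c (W ∪ W') (T ∪ T') (m + m') := by
  obtain ⟨X, L, hL, hX, hd, hLT, hm⟩ := h
  obtain ⟨X', L', hL', hX', hd', hLT', hm'⟩ := h'
  refine ⟨X ∪ X', L ++ L', hL.append hL', Set.union_subset_union hX hX', ?_, ?_, fun c => ?_⟩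
  · rw [List.flatten_append, List.nodup_append']
    exact ⟨hd, hd', fun z hz hz' => Set.disjoint_left.1 hT (hLT z hz) (hLT' z hz')⟩
  · intro z hz
    rw [List.flatten_append, List.mem_append] at hz
    exact hz.imp (hLT z) (hLT' z)
  · have : {z | z ∈ (L ++ L').flatten ∧ cls z = c} =
        {z | z ∈ L.flatten ∧ cls z = c} ∪ {z | z ∈ L'.flatten ∧ cls z = c} := by
      ext z
      simp only [List.flatten_append, List.mem_append, Set.mem_ofPred_eq, Set.mem_union]
      tauto
    rw [this]
    exact (Set.ncard_union_le _ _).trans (add_le_add (hm c) (hm' c))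

/-- `T` is the vertex set of a path of `G` from class `a` to class `b`. -/
def IsPathBetween (G : SimpleGraph V) (cls : V → α) (a b : α) (T : Set V) : Prop :=
  ∃ s t, cls s = a ∧ cls t = b ∧ ∃ p : G.Walk s t, p.IsPath ∧ T = {z | z ∈ p.support}

lemma IsPathBetween.symm {a b : α} {T : Set V} (h : IsPathBetween G cls a b T) :
    IsPathBetween G cls b a T := by
  obtain ⟨s, t, hs, ht, p, hp, rfl⟩ := h
  exact ⟨t, s, ht, hs, p.reverse, hp.reverse, by simp⟩

lemma IsPathBetween.hasTrailIn {a b : α} {T : Set V} (h : IsPathBetween G cls a b T) :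
    HasTrailIn G cls a b {a, b} T 2 := by
  classical
  obtain ⟨s, t, rfl, rfl, p, hp, rfl⟩ := h
  obtain ⟨W, L, hL, hsub, -, h2⟩ := exists_short_trail (cls := cls) p hp
  refine ⟨W, L, hL, ?_, hsub.nodup hp.support_nodup, fun z hz => hsub.subset hz, fun c => ?_⟩
  · rintro x (rfl | rfl)
    · exact hL.start_mem
    · exact hL.end_mem
  · refine le_trans ?_ (h2 c)
    have : {z | z ∈ L.flatten ∧ cls z = c} =
        ((L.flatten.filter (cls · = c)).toFinset : Set V) := by
      ext z; simp only [List.coe_toFinset, List.mem_filter, decide_eq_true_eq]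
    rw [this, Set.ncard_coe_finset, List.countP_eq_length_filter]
    exact List.toFinset_card_le _

lemma Trail.exists_walks {a b : α} {W : Set α} {L : List (List V)} (h : Trail G cls a b W L) :
    ∃ (q : Fin L.length → Σ u v : V, G.Walk u v) (x : Fin (L.length + 1) → α),
      x 0 = a ∧ x (Fin.last _) = b ∧ Set.range x = W ∧
      ∀ i, (q i).2.2.support = L.get i ∧ 0 < (q i).2.2.length ∧
        cls (q i).1 = x i.castSucc ∧ cls (q i).2.1 = x i.succ := by
  induction h with
  | nil a =>
    refine ⟨fun i => i.elim0, fun _ => a, rfl, rfl, ?_, fun i => i.elim0⟩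
    simp
  | @cons u v p hp b W L h ih =>
    obtain ⟨q, x, h0, hl, hr, hq⟩ := ih
    refine ⟨Fin.cons ⟨u, v, p⟩ q, Fin.cons (cls u) x, rfl, ?_, ?_, fun i => ?_⟩
    · exact hl
    · rw [Fin.range_cons, hr]
    · refine Fin.cases ?_ (fun i => ?_) i
      · exact ⟨rfl, hp, rfl, h0.symm⟩
      · exact hq i

/-- A closed trail, read in list order, is itself an Euler tour of the reduced multigraph of its
walks. -/
lemma HasTrailIn.exists_isTour {V : Type*} [Fintype V] [Nonempty V] {G : SimpleGraph V}
    (𝒱 : VertexPartition V 4 0) {a : Fin 4 ⊕ Fin 0} {T : Set V} {m : ℕ}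
    (h : HasTrailIn G 𝒱.cls a a Set.univ T m) :
    ∃ P : PathSystem G, IsTour 𝒱 P (m / Fintype.card V) := by
  obtain ⟨W, L, hL, hW, hd, -, hm⟩ := h
  obtain rfl : W = Set.univ := Set.univ_subset_iff.1 hW
  obtain ⟨q, x, h0, hl, hr, hq⟩ := hL.exists_walks
  rw [List.nodup_flatten] at hd
  refine ⟨⟨L.length, fun i => (q i).1, fun i => (q i).2.1, fun i => (q i).2.2, fun i => ?_,
    fun i => (hq i).2.1, fun i j hij z hz hz' => ?_⟩, ?_, fun c => ?_, fun j => j.elim0,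
    fun j => j.elim0⟩
  · rw [Walk.isPath_def, (hq i).1]
    exact hd.1 _ (List.get_mem _ _)
  · rw [(hq i).1] at hz
    rw [(hq j).1] at hz'
    have hpw := List.pairwise_iff_get.1 hd.2
    rcases lt_or_gt_of_ne hij with hlt | hlt
    · exact hpw _ _ hlt hz hz'
    · exact hpw _ _ hlt hz' hz
  · refine ⟨L.length, x, id, h0.trans hl.symm, fun i => ?_, Function.injective_id, ?_, hr⟩
    · change s(𝒱.cls (q i).1, 𝒱.cls (q i).2.1) = s(x i.castSucc, x i.succ)
      rw [(hq i).2.2.1, (hq i).2.2.2]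
    · rw [Set.range_id]
      symm
      rw [Set.eq_univ_iff_forall]
      intro e
      rw [Graph.edge_mem_iff_exists_isLink]
      exact ⟨_, _, rfl⟩
  · rw [Nat.card_eq_fintype_card, div_mul_cancel₀ _ (by simp)]
    refine le_trans ?_ (Nat.cast_le.2 (hm c))
    norm_cast
    refine Set.ncard_le_ncard ?_ (Set.toFinite _)
    rintro z ⟨⟨i, hi⟩, hz⟩
    refine ⟨?_, hz⟩
    rw [List.mem_flatten]
    have hi' : z ∈ (q i).2.2.support := hi
    rw [(hq i).1] at hi'
    exact ⟨_, List.get_mem _ _, hi'⟩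

end Trails

/-! ### Inserting a class into a cycle of paths -/

section Insertion

variable {V α : Type*} {G : SimpleGraph V} {cls : V → α}

/-- Stopping each walk at its first vertex in `U` keeps the walks disjoint. -/
lemma HasDisjointWalks.exists_fan {A U : Set V} {k : ℕ} (h : HasDisjointWalks G A U k) :
    ∃ (x u : Fin k → V) (p : ∀ i, G.Walk (x i) (u i)), (∀ i, x i ∈ A) ∧ (∀ i, u i ∈ U) ∧
      (∀ i, ∀ z ∈ (p i).support, z ∈ U → z = u i) ∧
      ∀ i j, i ≠ j → ∀ z, z ∈ (p i).support → z ∉ (p j).support := by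
  obtain ⟨x, y, p, hx, hy, hp⟩ := h
  choose u hu q _ hq hqU using fun i =>
    exists_first_hit U (p i) ⟨y i, (p i).end_mem_support, hy i⟩
  exact ⟨x, u, q, hx, hu, hqU, fun i j hij z hz hz' => hp i j hij z (hq i z hz) (hq j z hz')⟩

lemma exists_isPathBetween {s t : V} (p : G.Walk s t) :
    ∃ T, IsPathBetween G cls (cls s) (cls t) T ∧ ∀ z ∈ T, z ∈ p.support := by
  classical
  exact ⟨_, ⟨s, t, rfl, rfl, p.bypass, p.bypass_isPath, rfl⟩,
    fun z hz => p.support_bypass_subset_support hz⟩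

/-- A path through two vertices splits at them. -/
lemma exists_split {s t u v : V} (p : G.Walk s t) (hp : p.IsPath) (huv : u ≠ v)
    (hu : u ∈ p.support) (hv : v ∈ p.support) :
    ∃ y z, ((y = u ∧ z = v) ∨ (y = v ∧ z = u)) ∧ ∃ (q : G.Walk s y) (r : G.Walk z t),
      (∀ w ∈ q.support, w ∈ p.support) ∧ (∀ w ∈ r.support, w ∈ p.support) ∧
      ∀ w ∈ q.support, w ∉ r.support := by
  classical
  induction p with
  | nil =>
    simp only [Walk.support_nil, List.mem_singleton] at hu hv
    exact absurd (hu.trans hv.symm) huv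
  | @cons s x t hsx p ih =>
    obtain ⟨hp, hs⟩ := (Walk.cons_isPath_iff _ _).1 hp
    rw [Walk.support_cons, List.mem_cons] at hu hv
    have base : ∀ z (hz : z ∈ p.support), ∃ (q : G.Walk s s) (r : G.Walk z t),
        (∀ w ∈ q.support, w ∈ (Walk.cons hsx p).support) ∧
        (∀ w ∈ r.support, w ∈ (Walk.cons hsx p).support) ∧ ∀ w ∈ q.support, w ∉ r.support := by
      intro z hz
      refine ⟨Walk.nil, p.dropUntil z hz, by simp, fun w hw => ?_, fun w hw hw' => ?_⟩
      · exact List.mem_cons_of_mem _ (p.support_dropUntil_subset_support hz hw)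
      · simp only [Walk.support_nil, List.mem_singleton] at hw
        subst hw
        exact hs (p.support_dropUntil_subset_support hz hw')
    rcases hu with rfl | hu
    · exact ⟨u, v, Or.inl ⟨rfl, rfl⟩, base v (hv.resolve_left huv.symm)⟩
    rcases hv with rfl | hv
    · exact ⟨v, u, Or.inr ⟨rfl, rfl⟩, base u hu⟩
    obtain ⟨y, z, hyz, q, r, hq, hr, hqr⟩ := ih hp hu hv
    refine ⟨y, z, hyz, Walk.cons hsx q, r, fun w hw => ?_, fun w hw => ?_, fun w hw => ?_⟩
    · rw [Walk.support_cons, List.mem_cons] at hw ⊢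
      exact hw.imp_right (hq w)
    · exact List.mem_cons_of_mem _ (hr w hw)
    · rw [Walk.support_cons, List.mem_cons] at hw
      rcases hw with rfl | hw
      · exact fun h => hs (hr _ h)
      · exact hqr w hw

/-- Two disjoint walks from class `d` to the path `T` detour the path through class `d`. -/
lemma IsPathBetween.insert {a b d : α} {T U : Set V} (hT : IsPathBetween G cls a b T)
    (hTU : T ⊆ U) {x₁ u₁ x₂ u₂ : V} (r₁ : G.Walk x₁ u₁) (r₂ : G.Walk x₂ u₂)
    (hx₁ : cls x₁ = d) (hx₂ : cls x₂ = d) (hu₁ : u₁ ∈ T) (hu₂ : u₂ ∈ T)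
    (h₁ : ∀ z ∈ r₁.support, z ∈ U → z = u₁) (h₂ : ∀ z ∈ r₂.support, z ∈ U → z = u₂)
    (h₁₂ : ∀ z ∈ r₁.support, z ∉ r₂.support) :
    ∃ T₁ T₂, IsPathBetween G cls a d T₁ ∧ IsPathBetween G cls d b T₂ ∧ Disjoint T₁ T₂ ∧
      (∀ z ∈ T₁, z ∈ U → z ∈ T) ∧ (∀ z ∈ T₂, z ∈ U → z ∈ T) := by
  obtain ⟨s, t, rfl, rfl, p, hp, rfl⟩ := hT
  have hne : u₁ ≠ u₂ := fun h => h₁₂ u₁ r₁.end_mem_support (h ▸ r₂.end_mem_support)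
  obtain ⟨y, z, hyz, q, r, hq, hr, hqr⟩ := exists_split p hp hne hu₁ hu₂
  -- Stated for either order in which the two walks hit the path: the part before the first hit is
  -- followed back along `f` into class `d`, and `g` leads from class `d` to the part after the
  -- second.
  have key : ∀ {x x' : V} (f : G.Walk x y) (g : G.Walk x' z), cls x = d → cls x' = d →
      y ∈ p.support → z ∈ p.support → (∀ w ∈ f.support, w ∈ U → w = y) →
      (∀ w ∈ g.support, w ∈ U → w = z) → (∀ w ∈ f.support, w ∉ g.support) →
      ∃ T₁ T₂, IsPathBetween G cls (cls s) d T₁ ∧ IsPathBetween G cls d (cls t) T₂ ∧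
        Disjoint T₁ T₂ ∧ (∀ z ∈ T₁, z ∈ U → z ∈ {z | z ∈ p.support}) ∧
        (∀ z ∈ T₂, z ∈ U → z ∈ {z | z ∈ p.support}) := by
    intro x x' f g hx hx' hy hz hf hg hfg
    obtain ⟨T₁, hT₁, hT₁'⟩ := exists_isPathBetween (cls := cls) (q.append f.reverse)
    obtain ⟨T₂, hT₂, hT₂'⟩ := exists_isPathBetween (cls := cls) (g.append r)
    rw [hx] at hT₁
    rw [hx'] at hT₂
    simp only [Walk.mem_support_append_iff, Walk.support_reverse, List.mem_reverse] at hT₁' hT₂'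
    refine ⟨T₁, T₂, hT₁, hT₂, Set.disjoint_left.2 fun w hw hw' => ?_, fun w hw hwU => ?_,
      fun w hw hwU => ?_⟩
    · rcases hT₁' w hw with h | h <;> rcases hT₂' w hw' with h' | h'
      · obtain rfl := hg w h' (hTU (hq w h))
        exact hqr w h r.start_mem_support
      · exact hqr w h h'
      · exact hfg w h h'
      · obtain rfl := hf w h (hTU (hr w h'))
        exact hqr w q.end_mem_support h'
    · rcases hT₁' w hw with h | h
      · exact hq w h
      · exact hf w h hwU ▸ hy
    · rcases hT₂' w hw with h | h
      · exact hg w h hwU ▸ hz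
      · exact hr w h
  rcases hyz with ⟨rfl, rfl⟩ | ⟨rfl, rfl⟩
  · exact key r₁ r₂ hx₁ hx₂ hu₁ hu₂ h₁ h₂ h₁₂
  · exact key r₂ r₁ hx₂ hx₁ hu₂ hu₁ h₂ h₁ fun w hw hw' => h₁₂ w hw' hw

/-- Any two sets of three vertices are joined by three disjoint walks. -/
def IsTriplyLinked (G : SimpleGraph V) : Prop :=
  ∀ A B : Set V, 3 ≤ A.ncard → 3 ≤ B.ncard → HasDisjointWalks G A B 3

lemma HasDisjointWalks.mono {A B : Set V} {k l : ℕ} (h : HasDisjointWalks G A B l) (hkl : k ≤ l) :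
    HasDisjointWalks G A B k := by
  obtain ⟨x, y, p, hx, hy, hp⟩ := h
  exact ⟨fun i => x (i.castLE hkl), fun i => y (i.castLE hkl), fun i => p (i.castLE hkl),
    fun i => hx _, fun i => hy _, fun i j hij => hp _ _ (by simpa using hij)⟩

/-- After a detour, a new path meets the old configuration `U` only in the path it replaces, so it
stays disjoint from the others. -/
lemma disjoint_of_trace_subset {U T T' X : Set V} (hX : ∀ z ∈ X, z ∈ U → z ∈ T) (hT' : T' ⊆ U)
    (h : Disjoint T T') : Disjoint X T' :=
  Set.disjoint_left.2 fun z hz hz' => Set.disjoint_left.1 h (hX z hz (hT' hz')) hz'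

/-- Two disjoint paths between `a` and `c` have at least four vertices together. Of three disjoint
walks from `d` to them, two end on the same path. That path is detoured through `d`, and the other
closes the triangle. -/
lemma IsTriplyLinked.exists_triangle [Finite V] (hG : IsTriplyLinked G) {a c d : α} (hac : a ≠ c)
    (ha : 3 ≤ (cls ⁻¹' {a}).ncard) (hc : 3 ≤ (cls ⁻¹' {c}).ncard)
    (hd : 3 ≤ (cls ⁻¹' {d}).ncard) :
    ∃ T₁ T₂ T₃, IsPathBetween G cls a c T₁ ∧ IsPathBetween G cls c d T₂ ∧
      IsPathBetween G cls d a T₃ ∧ Disjoint T₁ T₂ ∧ Disjoint T₁ T₃ ∧ Disjoint T₂ T₃ := by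
  obtain ⟨x, y, p, hx, hy, hp⟩ := (hG _ _ ha hc).mono (show 2 ≤ 3 by norm_num)
  obtain ⟨S₁, hS₁, hS₁'⟩ := exists_isPathBetween (cls := cls) (p 0)
  obtain ⟨S₂, hS₂, hS₂'⟩ := exists_isPathBetween (cls := cls) (p 1)
  rw [hx 0, hy 0] at hS₁
  rw [hx 1, hy 1] at hS₂
  have hS : Disjoint S₁ S₂ := Set.disjoint_left.2 fun z hz hz' =>
    hp 0 1 (by simp) z (hS₁' z hz) (hS₂' z hz')
  have htwo : ∀ S, IsPathBetween G cls a c S → 2 ≤ S.ncard := by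
    rintro S ⟨s, t, rfl, rfl, p, -, rfl⟩
    have hst : s ≠ t := fun h => hac (h ▸ rfl)
    rw [← Set.ncard_pair hst]
    refine Set.ncard_le_ncard ?_ (Set.toFinite _)
    rintro z (rfl | rfl)
    · exact p.start_mem_support
    · exact p.end_mem_support
  have hcard : 3 ≤ (S₁ ∪ S₂).ncard := by
    rw [Set.ncard_union_eq hS (Set.toFinite _) (Set.toFinite _)]
    have := htwo _ hS₁
    have := htwo _ hS₂
    omega
  obtain ⟨x, u, p, hx, hu, hpU, hp⟩ := (hG _ _ hd hcard).exists_fan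
  have hx : ∀ i, cls (x i) = d := hx
  have hpigeon : ∃ i j, i ≠ j ∧ ((u i ∈ S₁ ∧ u j ∈ S₁) ∨ (u i ∈ S₂ ∧ u j ∈ S₂)) := by
    have h0 := hu 0
    have h1 := hu 1
    have h2 := hu 2
    rcases h0 with h0 | h0 <;> rcases h1 with h1 | h1 <;> rcases h2 with h2 | h2
    all_goals first
      | exact ⟨0, 1, by decide, Or.inl ⟨h0, h1⟩⟩
      | exact ⟨0, 1, by decide, Or.inr ⟨h0, h1⟩⟩
      | exact ⟨0, 2, by decide, Or.inl ⟨h0, h2⟩⟩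
      | exact ⟨0, 2, by decide, Or.inr ⟨h0, h2⟩⟩
      | exact ⟨1, 2, by decide, Or.inl ⟨h1, h2⟩⟩
      | exact ⟨1, 2, by decide, Or.inr ⟨h1, h2⟩⟩
  obtain ⟨i, j, hij, ⟨hi, hj⟩ | ⟨hi, hj⟩⟩ := hpigeon
  · obtain ⟨T₁, T₂, hT₁, hT₂, hd', h1, h2⟩ := hS₁.insert Set.subset_union_left (p i) (p j) (hx i)
      (hx j) hi hj (hpU i) (hpU j) (hp i j hij)
    exact ⟨S₂, T₂, T₁, hS₂, hT₂.symm, hT₁.symm,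
      (disjoint_of_trace_subset h2 Set.subset_union_right hS).symm,
      (disjoint_of_trace_subset h1 Set.subset_union_right hS).symm, hd'.symm⟩
  · obtain ⟨T₁, T₂, hT₁, hT₂, hd', h1, h2⟩ := hS₂.insert Set.subset_union_right (p i) (p j) (hx i)
      (hx j) hi hj (hpU i) (hpU j) (hp i j hij)
    exact ⟨S₁, T₂, T₁, hS₁, hT₂.symm, hT₁.symm,
      (disjoint_of_trace_subset h2 Set.subset_union_left hS.symm).symm,
      (disjoint_of_trace_subset h1 Set.subset_union_left hS.symm).symm, hd'.symm⟩

lemma HasTrailIn.mono {a b : α} {W W' : Set α} {T : Set V} {m m' : ℕ}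
    (h : HasTrailIn G cls a b W T m) (hW : W' ⊆ W) (hm : m ≤ m') :
    HasTrailIn G cls a b W' T m' := by
  obtain ⟨X, L, hL, hX, hd, hT, hc⟩ := h
  exact ⟨X, L, hL, hW.trans hX, hd, hT, fun c => (hc c).trans hm⟩

lemma hasTrailIn_of_quadrangle [Finite V] {a b c d : α} {T₁ T₂ T₃ T₄ : Set V}
    (h₁ : IsPathBetween G cls a b T₁) (h₂ : IsPathBetween G cls b c T₂)
    (h₃ : IsPathBetween G cls c d T₃) (h₄ : IsPathBetween G cls d a T₄)
    (h₁₂ : Disjoint T₁ T₂) (h₁₃ : Disjoint T₁ T₃) (h₁₄ : Disjoint T₁ T₄) (h₂₃ : Disjoint T₂ T₃)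
    (h₂₄ : Disjoint T₂ T₄) (h₃₄ : Disjoint T₃ T₄) :
    ∃ T, HasTrailIn G cls a a {a, b, c, d} T 8 := by
  have h := ((h₁.hasTrailIn.append h₂.hasTrailIn h₁₂).append h₃.hasTrailIn
    (Set.disjoint_union_left.2 ⟨h₁₃, h₂₃⟩)).append h₄.hasTrailIn
    (Set.disjoint_union_left.2 ⟨Set.disjoint_union_left.2 ⟨h₁₄, h₂₄⟩, h₃₄⟩)
  exact ⟨_, h.mono (by rintro x (rfl | rfl | rfl | rfl) <;> simp) le_rfl⟩

/-- Four disjoint walks lead from `b` to the triangle or to class `a`. Two ending on the same side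
detour that side; two ending in class `a` off the triangle form an extra closed excursion to `b`.
Failing both, one walk ends on each side and one in class `a` off the triangle, and the latter, with
the walk ending on `T₁`, reroutes that side through `b`. -/
lemma IsTriplyLinked.exists_hasTrailIn [Finite V] (hG : IsTriplyLinked G) {a b c d : α}
    (hac : a ≠ c) (ha : 3 ≤ (cls ⁻¹' {a}).ncard) (hc : 3 ≤ (cls ⁻¹' {c}).ncard)
    (hd : 3 ≤ (cls ⁻¹' {d}).ncard)
    (hab : ∀ S : Finset V, Separates G (cls ⁻¹' {b}) (cls ⁻¹' {a}) S → 4 ≤ S.card) :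
    ∃ e T, HasTrailIn G cls e e {a, b, c, d} T 10 := by
  obtain ⟨T₁, T₂, T₃, h₁, h₂, h₃, h₁₂, h₁₃, h₂₃⟩ := hG.exists_triangle (cls := cls) hac ha hc hd
  set U := T₁ ∪ T₂ ∪ T₃ ∪ cls ⁻¹' {a} with hU
  have hU₁ : T₁ ⊆ U := fun z hz => Or.inl (Or.inl (Or.inl hz))
  have hU₂ : T₂ ⊆ U := fun z hz => Or.inl (Or.inl (Or.inr hz))
  have hU₃ : T₃ ⊆ U := fun z hz => Or.inl (Or.inr hz)
  -- The target includes class `a`, so a separator of `b` from `U` also separates `b` from `a`.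
  have hfan : HasDisjointWalks G (cls ⁻¹' {b}) U 4 :=
    hasDisjointWalks_of_separates G _ _ 4 fun S hS => hab S fun x hx y hy p =>
      hS x hx y (Or.inr hy) p
  obtain ⟨x, u, p, hx, hu, hpU, hp⟩ := hfan.exists_fan
  have hx : ∀ i, cls (x i) = b := hx
  by_cases hex₁ : ∃ i j, i ≠ j ∧ u i ∈ T₁ ∧ u j ∈ T₁
  · obtain ⟨i, j, hij, hi, hj⟩ := hex₁
    obtain ⟨S₁, S₂, hS₁, hS₂, hd', k1, k2⟩ := h₁.insert hU₁ (p i) (p j) (hx i)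
      (hx j) hi hj (hpU i) (hpU j) (hp i j hij)
    obtain ⟨T, hT⟩ := hasTrailIn_of_quadrangle hS₁ hS₂ h₂ h₃ hd'
      (disjoint_of_trace_subset k1 hU₂ h₁₂) (disjoint_of_trace_subset k1 hU₃ h₁₃)
      (disjoint_of_trace_subset k2 hU₂ h₁₂) (disjoint_of_trace_subset k2 hU₃ h₁₃) h₂₃
    exact ⟨_, T, hT.mono (by rintro x (rfl | rfl | rfl | rfl) <;> simp) (by norm_num)⟩
  by_cases hex₂ : ∃ i j, i ≠ j ∧ u i ∈ T₂ ∧ u j ∈ T₂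
  · obtain ⟨i, j, hij, hi, hj⟩ := hex₂
    obtain ⟨S₁, S₂, hS₁, hS₂, hd', k1, k2⟩ := h₂.insert hU₂ (p i) (p j) (hx i)
      (hx j) hi hj (hpU i) (hpU j) (hp i j hij)
    obtain ⟨T, hT⟩ := hasTrailIn_of_quadrangle hS₁ hS₂ h₃ h₁ hd'
      (disjoint_of_trace_subset k1 hU₃ h₂₃) (disjoint_of_trace_subset k1 hU₁ h₁₂.symm)
      (disjoint_of_trace_subset k2 hU₃ h₂₃) (disjoint_of_trace_subset k2 hU₁ h₁₂.symm) h₁₃.symm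
    exact ⟨_, T, hT.mono (by rintro x (rfl | rfl | rfl | rfl) <;> simp) (by norm_num)⟩
  by_cases hex₃ : ∃ i j, i ≠ j ∧ u i ∈ T₃ ∧ u j ∈ T₃
  · obtain ⟨i, j, hij, hi, hj⟩ := hex₃
    obtain ⟨S₁, S₂, hS₁, hS₂, hd', k1, k2⟩ := h₃.insert hU₃ (p i) (p j) (hx i)
      (hx j) hi hj (hpU i) (hpU j) (hp i j hij)
    obtain ⟨T, hT⟩ := hasTrailIn_of_quadrangle hS₁ hS₂ h₁ h₂ hd'
      (disjoint_of_trace_subset k1 hU₁ h₁₃.symm) (disjoint_of_trace_subset k1 hU₂ h₂₃.symm)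
      (disjoint_of_trace_subset k2 hU₁ h₁₃.symm) (disjoint_of_trace_subset k2 hU₂ h₂₃.symm) h₁₂
    exact ⟨_, T, hT.mono (by rintro x (rfl | rfl | rfl | rfl) <;> simp) (by norm_num)⟩
  -- the walks that end in class `a` outside the triangle
  have hdir : ∀ i, u i ∉ T₁ → u i ∉ T₂ → u i ∉ T₃ → ∃ T, IsPathBetween G cls a b T ∧
      (∀ z ∈ T, z ∈ (p i).support) ∧ ∀ z ∈ T, z ∈ U → z ∈ ({u i} : Set V) := by
    intro i n1 n2 n3
    have hua : cls (u i) = a := by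
      rcases hu i with ((h | h) | h) | h
      · exact absurd h n1
      · exact absurd h n2
      · exact absurd h n3
      · exact h
    obtain ⟨T, hT, hT'⟩ := exists_isPathBetween (cls := cls) (p i).reverse
    rw [hua, hx i] at hT
    have hT' : ∀ z ∈ T, z ∈ (p i).support := fun z hz => by simpa using hT' z hz
    exact ⟨T, hT, hT', fun z hz hzU => hpU i z (hT' z hz) hzU⟩
  by_cases hex : ∃ i j, i ≠ j ∧ (u i ∉ T₁ ∧ u i ∉ T₂ ∧ u i ∉ T₃) ∧
      (u j ∉ T₁ ∧ u j ∉ T₂ ∧ u j ∉ T₃)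
  · obtain ⟨i, j, hij, ⟨i1, i2, i3⟩, ⟨j1, j2, j3⟩⟩ := hex
    obtain ⟨S₁, hS₁, k1, k1'⟩ := hdir i i1 i2 i3
    obtain ⟨S₂, hS₂, k2, k2'⟩ := hdir j j1 j2 j3
    have hS : Disjoint S₁ S₂ := Set.disjoint_left.2 fun z hz hz' =>
      hp i j hij z (k1 z hz) (k2 z hz')
    have e1 := fun T (hT : T ⊆ U) hi => disjoint_of_trace_subset (T' := T) k1' hT
      (Set.disjoint_singleton_left.2 hi)
    have e2 := fun T (hT : T ⊆ U) hj => disjoint_of_trace_subset (T' := T) k2' hT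
      (Set.disjoint_singleton_left.2 hj)
    -- From `a` to `b` and back, then around the triangle: five paths with two vertices per class
    -- give the bound 10.
    have h := (((hS₁.hasTrailIn.append hS₂.symm.hasTrailIn hS).append h₁.hasTrailIn
      (Set.disjoint_union_left.2 ⟨e1 _ hU₁ i1, e2 _ hU₁ j1⟩)).append h₂.hasTrailIn
      (Set.disjoint_union_left.2 ⟨Set.disjoint_union_left.2 ⟨e1 _ hU₂ i2, e2 _ hU₂ j2⟩,
        h₁₂⟩)).append h₃.hasTrailIn
      (Set.disjoint_union_left.2 ⟨Set.disjoint_union_left.2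
        ⟨Set.disjoint_union_left.2 ⟨e1 _ hU₃ i3, e2 _ hU₃ j3⟩, h₁₃⟩, h₂₃⟩)
    exact ⟨a, _, h.mono (by rintro x (rfl | rfl | rfl | rfl) <;> simp) le_rfl⟩
  -- one walk ends on each path of the triangle and one in class `a` outside of it
  classical
  let f : Fin 4 → Fin 4 := fun i =>
    if u i ∈ T₁ then 0 else if u i ∈ T₂ then 1 else if u i ∈ T₃ then 2 else 3
  have hf : Function.Injective f := by
    intro i j hfij
    by_contra hij
    by_cases i1 : u i ∈ T₁ <;> by_cases j1 : u j ∈ T₁ <;> by_cases i2 : u i ∈ T₂ <;>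
      by_cases j2 : u j ∈ T₂ <;> by_cases i3 : u i ∈ T₃ <;> by_cases j3 : u j ∈ T₃ <;>
      simp [f, i1, j1, i2, j2, i3, j3] at hfij <;>
      first
        | exact hex₁ ⟨i, j, hij, i1, j1⟩
        | exact hex₂ ⟨i, j, hij, i2, j2⟩
        | exact hex₃ ⟨i, j, hij, i3, j3⟩
        | exact hex ⟨i, j, hij, ⟨i1, i2, i3⟩, ⟨j1, j2, j3⟩⟩
  have hsurj := Finite.surjective_of_injective hf
  obtain ⟨i, hi⟩ := hsurj 3
  obtain ⟨j, hj⟩ := hsurj 0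
  have hij : i ≠ j := by rintro rfl; rw [hi] at hj; exact absurd hj (by decide)
  have hj1 : u j ∈ T₁ := by
    by_contra h
    simp only [f, h, if_false] at hj
    split_ifs at hj
    all_goals exact absurd hj (by decide)
  have hi' : u i ∉ T₁ ∧ u i ∉ T₂ ∧ u i ∉ T₃ := by
    simp only [f] at hi
    split_ifs at hi
    all_goals first | exact absurd hi (by decide) | exact ⟨by assumption, by assumption, by assumption⟩
  obtain ⟨S₁, hS₁, k1, k1'⟩ := hdir i hi'.1 hi'.2.1 hi'.2.2
  obtain ⟨s, t, -, ht, q, hq, rfl⟩ := h₁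
  have hj1' : u j ∈ q.support := hj1
  -- From `b` to `T₁` and along it to `c`; together with `S₁` this replaces `T₁`.
  obtain ⟨S₂, hS₂, k2⟩ := exists_isPathBetween (cls := cls) ((p j).append (q.dropUntil (u j) hj1'))
  rw [hx j, ht] at hS₂
  have k2 : ∀ z ∈ S₂, z ∈ (p j).support ∨ z ∈ q.support := fun z hz =>
    ((Walk.mem_support_append_iff _ _).1 (k2 z hz)).imp_right
      fun h => q.support_dropUntil_subset_support hj1' h
  have k2' : ∀ z ∈ S₂, z ∈ U → z ∈ {z | z ∈ q.support} := fun z hz hzU =>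
    (k2 z hz).elim (fun h => hpU j z h hzU ▸ hj1) id
  have e1 := fun T (hT : T ⊆ U) hi => disjoint_of_trace_subset (T' := T) k1' hT
    (Set.disjoint_singleton_left.2 hi)
  have hS : Disjoint S₁ S₂ := Set.disjoint_left.2 fun z hz hz' => by
    rcases k2 z hz' with h | h
    · exact hp i j hij z (k1 z hz) h
    · exact Set.disjoint_left.1 (e1 _ hU₁ hi'.1) hz h
  obtain ⟨T, hT⟩ := hasTrailIn_of_quadrangle hS₁ hS₂ h₂ h₃ hS (e1 _ hU₂ hi'.2.1)
    (e1 _ hU₃ hi'.2.2) (disjoint_of_trace_subset k2' hU₂ h₁₂)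
    (disjoint_of_trace_subset k2' hU₃ h₁₃) h₂₃
  exact ⟨_, T, hT.mono (by rintro x (rfl | rfl | rfl | rfl) <;> simp) (by norm_num)⟩

end Insertion

/-! ### Connectivity between the classes -/

section Connectivity

variable {V α : Type*} {G : SimpleGraph V} {cls : V → α}

/-- Fewer than three vertices cannot contain either set, and deleting them leaves the graph
connected, so Menger's theorem applies. -/
lemma IsKConnected.isTriplyLinked [Finite V] (h : IsKConnected G 3) : IsTriplyLinked G := by
  intro A B hA hB
  refine hasDisjointWalks_of_separates G A B 3 fun S hS => ?_
  by_contra hlt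
  push Not at hlt
  have hS' : (S : Set V).ncard < 3 := by rwa [Set.ncard_coe_finset]
  have hconn := h.2 S hS'
  obtain ⟨a, ha, haS⟩ := Set.exists_mem_notMem_of_ncard_lt_ncard (hS'.trans_le hA)
  obtain ⟨b, hb, hbS⟩ := Set.exists_mem_notMem_of_ncard_lt_ncard (hS'.trans_le hB)
  obtain ⟨p⟩ := hconn.preconnected ⟨a, haS⟩ ⟨b, hbS⟩
  have hp := Walk.support_map (Embedding.induce ((S : Set V)ᶜ)).toHom p
  obtain ⟨z, hz, hzS⟩ := hS a ha b hb (p.map (Embedding.induce _).toHom)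
  obtain ⟨w, -, rfl⟩ := List.mem_map.1 (hp ▸ hz :)
  exact w.2 (by simpa using hzS)

/-- Each `t c` lies between `4 - 2 * s` and `s`, so the squares sum to at most `16 * s ^ 2`. Then
`(D + 1) * (4 + s) - 16 * s ^ 2 ≤ s * D`, where the terms `s * D` cancel and `4 * D` remains. -/
lemma le_of_sum_excess_le [Fintype α] (hα : Fintype.card α = 4) (t : α → ℤ) (s D : ℤ)
    (hts : ∀ c, t c ≤ s) (hsum : 4 + s ≤ ∑ c, t c)
    (h : ∑ c, (D + 1 - t c) * t c ≤ s * D) (hD : 0 ≤ D) : D ≤ 4 * s ^ 2 := by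
  classical
  have hlow : ∀ c, 4 - 2 * s ≤ t c := by
    intro c
    have h1 := Finset.add_sum_erase Finset.univ t (Finset.mem_univ c)
    have h2 : ∑ x ∈ Finset.univ.erase c, t x ≤ ∑ _x ∈ Finset.univ.erase c, s :=
      Finset.sum_le_sum fun x _ => hts x
    rw [Finset.sum_const, Finset.card_erase_of_mem (Finset.mem_univ c), Finset.card_univ, hα] at h2
    simp at h2
    linarith
  have hsq : ∑ c, t c ^ 2 ≤ ∑ _c : α, 4 * s ^ 2 := by
    refine Finset.sum_le_sum fun c _ => ?_
    nlinarith [hlow c, hts c]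
  rw [Finset.sum_const, Finset.card_univ, hα] at hsq
  have hexp : ∑ c, (D + 1 - t c) * t c = (D + 1) * ∑ c, t c - ∑ c, t c ^ 2 := by
    rw [Finset.mul_sum, ← Finset.sum_sub_distrib]
    exact Finset.sum_congr rfl fun c _ => by ring
  rw [hexp] at h
  simp at hsq
  have hs : 0 ≤ s := by
    obtain ⟨c⟩ : Nonempty α := Fintype.card_pos_iff.1 (by omega)
    linarith [hlow c, hts c]
  nlinarith

/-- In a `D`-regular graph on at most `4D` vertices with four classes, only few vertices cannot
cover all edges between different classes. -/
lemma le_of_cover [Fintype V] [DecidableEq V] [DecidableRel G.Adj] [Fintype α] [DecidableEq α]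
    (hα : Fintype.card α = 4) {D : ℕ} (hreg : ∀ v, (Finset.univ.filter (G.Adj v)).card = D)
    (hn : Fintype.card V ≤ 4 * D) (S : Finset V)
    (hS : ∀ u v, G.Adj u v → cls u ≠ cls v → u ∈ S ∨ v ∈ S)
    (hlarge : ∀ c, ∃ v, v ∉ S ∧ cls v = c) : D ≤ 4 * S.card ^ 2 := by
  let Y : α → Finset V := fun c => Finset.univ.filter fun v => v ∉ S ∧ cls v = c
  let dS : V → ℕ := fun v => (S.filter (G.Adj v)).card
  -- An uncovered vertex has all its neighbours in `S` or among the other uncovered vertices of its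
  -- class; the `+ 1` is the vertex itself.
  have hdeg : ∀ v, v ∉ S → D + 1 ≤ dS v + (Y (cls v)).card := by
    intro v hv
    have hsub : Finset.univ.filter (G.Adj v) ⊆ S.filter (G.Adj v) ∪ (Y (cls v)).erase v := by
      intro w hw
      simp only [Finset.mem_filter, Finset.mem_univ, true_and] at hw
      simp only [Y, Finset.mem_union, Finset.mem_filter, Finset.mem_erase, Finset.mem_univ,
        true_and]
      by_cases hwS : w ∈ S
      · exact Or.inl ⟨hwS, hw⟩
      · refine Or.inr ⟨hw.ne', hwS, ?_⟩
        by_contra hne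
        exact (hS v w hw (Ne.symm hne)).elim hv hwS
    have h1 := (Finset.card_le_card hsub).trans (Finset.card_union_le _ _)
    have hvY : v ∈ Y (cls v) := by simp [Y, hv]
    rw [hreg v] at h1
    have h2 := Finset.card_erase_add_one hvY
    simp only [dS]
    omega
  have hcount : ∑ v ∈ Finset.univ.filter (· ∉ S), dS v ≤ S.card * D := by
    calc ∑ v ∈ Finset.univ.filter (· ∉ S), dS v
        ≤ ∑ v, dS v := Finset.sum_le_sum_of_subset (Finset.subset_univ _)
      _ = ∑ z ∈ S, (Finset.univ.filter (G.Adj z)).card := by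
          simp only [dS, Finset.card_filter]
          rw [Finset.sum_comm]
          refine Finset.sum_congr rfl fun z _ => Finset.sum_congr rfl fun v _ => ?_
          simp [G.adj_comm]
      _ = S.card * D := by simp [hreg]
  have hfiber : ∀ f : V → ℤ, ∑ v ∈ Finset.univ.filter (· ∉ S), f v = ∑ c, ∑ v ∈ Y c, f v := by
    intro f
    rw [← Finset.sum_fiberwise (Finset.univ.filter (· ∉ S)) cls f]
    simp only [Y, Finset.filter_filter]
  have htotal : ∑ c, ((Y c).card : ℤ) = Fintype.card V - S.card := by
    have h1 := hfiber fun _ => 1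
    simp only [Finset.sum_const, nsmul_eq_mul, mul_one] at h1
    rw [← h1]
    have h2 := Finset.card_filter_add_card_filter_not (s := (Finset.univ : Finset V)) (· ∈ S)
    simp only [Finset.filter_mem_eq_inter, Finset.univ_inter, Finset.card_univ] at h2
    omega
  -- `D + 1 - (Y c).card` is a lower bound for the number of neighbours in `S` of each vertex of `Y
  -- c`.
  have key := le_of_sum_excess_le hα (fun c => (D : ℤ) + 1 - (Y c).card) S.card D ?_ ?_ ?_
    (by positivity)
  · exact_mod_cast key
  · intro c
    obtain ⟨v, hv, rfl⟩ := hlarge c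
    have h1 := hdeg v hv
    have h2 : dS v ≤ S.card := Finset.card_filter_le _ _
    omega
  · rw [Finset.sum_sub_distrib, htotal, Finset.sum_const, Finset.card_univ, hα]
    simp only [nsmul_eq_mul]
    push_cast
    have : (Fintype.card V : ℤ) ≤ 4 * D := by exact_mod_cast hn
    linarith
  · calc ∑ c, ((D : ℤ) + 1 - (D + 1 - (Y c).card)) * (D + 1 - (Y c).card)
        = ∑ c, ∑ v ∈ Y c, ((D : ℤ) + 1 - (Y c).card) := by
          refine Finset.sum_congr rfl fun c _ => ?_
          rw [Finset.sum_const, nsmul_eq_mul]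
          ring
      _ ≤ ∑ c, ∑ v ∈ Y c, (dS v : ℤ) := by
          refine Finset.sum_le_sum fun c _ => Finset.sum_le_sum fun v hv => ?_
          obtain ⟨hvS, rfl⟩ := (Finset.mem_filter.1 hv).2
          have := hdeg v hvS
          omega
      _ = ∑ v ∈ Finset.univ.filter (· ∉ S), (dS v : ℤ) := (hfiber _).symm
      _ ≤ S.card * D := by exact_mod_cast hcount

/-- Some two classes cannot be separated by three vertices. -/
lemma exists_linked_pair [Fintype V] [Fintype α] (hα : Fintype.card α = 4) {D : ℕ}
    (hreg : ∀ v, (G.neighborSet v).ncard = D) (hn : Fintype.card V ≤ 4 * D)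
    (hlarge : ∀ c, 48 < (cls ⁻¹' {c}).ncard) (hD : 9216 < D) :
    ∃ a b, a ≠ b ∧ ∀ S : Finset V, Separates G (cls ⁻¹' {b}) (cls ⁻¹' {a}) S → 4 ≤ S.card := by
  classical
  by_contra! hcon
  have hsep : ∀ a b, ∃ S : Finset V, S.card ≤ 3 ∧
      (a ≠ b → Separates G (cls ⁻¹' {b}) (cls ⁻¹' {a}) S) := by
    intro a b
    by_cases hab : a = b
    · exact ⟨∅, by simp, fun h => absurd hab h⟩
    · obtain ⟨S, hS, hS'⟩ := hcon a b hab
      exact ⟨S, by omega, fun _ => hS⟩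
  choose S hS hSsep using hsep
  -- All 16 ordered pairs, the diagonal included, with at most three vertices each: 48 in total, and
  -- 9216 is `4 * 48 ^ 2`.
  let X := (Finset.univ : Finset (α × α)).biUnion fun c => S c.1 c.2
  have hX : X.card ≤ 48 := by
    refine Finset.card_biUnion_le.trans ?_
    refine (Finset.sum_le_sum fun c _ => hS c.1 c.2).trans ?_
    simp [hα]
  have h := le_of_cover (G := G) (cls := cls) hα (D := D) (fun v => ?_) hn X ?_ ?_
  · have : X.card ^ 2 ≤ 48 ^ 2 := Nat.pow_le_pow_left hX 2
    omega
  · rw [← hreg v, ← Set.ncard_coe_finset]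
    congr 1
    ext w
    simp
  · intro u v huv hne
    -- An edge between two classes is a walk between them, so their separator contains one of its
    -- ends.
    obtain ⟨z, hz, hzS⟩ := hSsep _ _ hne v rfl u rfl huv.symm.toWalk
    have hzX : z ∈ X := Finset.mem_biUnion.2 ⟨(cls u, cls v), Finset.mem_univ _, hzS⟩
    simp only [Adj.toWalk, Walk.support_cons, Walk.support_nil, List.mem_cons,
      List.not_mem_nil, or_false] at hz
    rcases hz with rfl | rfl
    · exact Or.inr hzX
    · exact Or.inl hzX
  · intro c
    have : (X : Set V).ncard < (cls ⁻¹' {c}).ncard := by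
      rw [Set.ncard_coe_finset]
      exact hX.trans_lt (hlarge c)
    obtain ⟨v, hv, hvX⟩ := Set.exists_mem_notMem_of_ncard_lt_ncard this
    exact ⟨v, by simpa using hvX, hv⟩

end Connectivity

end RegularHam

/-! ### Constants and conclusion -/

theorem lemma5p1 :
    ∃ f : ℝ → ℝ, Set.MapsTo f (Set.Ioc 0 1) (Set.Ioc 0 1) ∧ MonotoneOn f (Set.Ioc 0 1) ∧
      ∀ (D n : ℕ) (ρ ν τ : ℝ), 0 < D → 0 < n →
        ρ ∈ Set.Ioc (0 : ℝ) 1 → ν ∈ Set.Ioc (0 : ℝ) 1 → τ ∈ Set.Ioc (0 : ℝ) 1 →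
        1 / (n : ℝ) ≤ f ρ → ρ ≤ f ν → ν ≤ f τ → τ ≤ f 1 →
        ∀ (V : Type*) [Fintype V] (G : SimpleGraph V) [G.LocallyFinite],
          Fintype.card V = n → RegularHam.IsKConnected G 3 → G.IsRegularOfDegree D →
          (n : ℝ) / 4 ≤ D →
          ∀ 𝒱 : RegularHam.VertexPartition V 4 0,
            RegularHam.IsRobustPartition G D 𝒱 ρ ν τ →
            ∃ P : RegularHam.PathSystem G, RegularHam.IsTour 𝒱 P (33 / n) := by
  -- The slope gives `ρ * n ≥ 100000`. Hence every class has more than 48 vertices, as `√ρ ≥ ρ`, and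
  -- `D ≥ n / 4` exceeds 9216.
  refine ⟨fun x => x / 100000, fun x hx => ⟨by have := hx.1; positivity, by
    have := hx.2; dsimp only; linarith⟩, fun x _ y _ hxy => by dsimp only; linarith, ?_⟩
  intro D n ρ ν τ _ hn hρ _ _ hnρ _ _ _ V _ G _ hV hconn hreg hD 𝒱 h𝒱
  have hn' : (0 : ℝ) < n := by exact_mod_cast hn
  have hρn : 100000 ≤ ρ * n := by
    rw [div_le_div_iff₀ hn' (by norm_num)] at hnρ
    linarith
  have hnbig : (100000 : ℝ) ≤ n := hρn.trans (by nlinarith [hρ.2])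
  have hDbig : 9216 < D := by
    have : (9216 : ℝ) < D := by linarith
    exact_mod_cast this
  have hn4 : Fintype.card V ≤ 4 * D := by
    rw [hV]
    have : (n : ℝ) ≤ 4 * D := by linarith
    exact_mod_cast this
  have hlarge : ∀ c, 48 < (𝒱.cls ⁻¹' {c}).ncard := by
    rintro (i | j)
    · have h1 : √ρ * Nat.card V ≤ (𝒱.cls ⁻¹' {Sum.inl i}).ncard := (h𝒱.expander i).1.1
      rw [Nat.card_eq_fintype_card, hV] at h1
      have h2 : ρ ≤ √ρ := Real.le_sqrt_of_sq_le (by nlinarith [hρ.1, hρ.2])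
      have h3 : ρ * n ≤ √ρ * n := mul_le_mul_of_nonneg_right h2 hn'.le
      have : (48 : ℝ) < (𝒱.cls ⁻¹' {Sum.inl i}).ncard := by linarith
      exact_mod_cast this
    · exact j.elim0
  have hdeg : ∀ v, (G.neighborSet v).ncard = D := by
    intro v
    rw [← hreg v, ← SimpleGraph.card_neighborSet_eq_degree, Set.ncard_eq_toFinset_card',
      Set.toFinset_card]
  obtain ⟨a, b, hab, hlink⟩ :=
    RegularHam.exists_linked_pair (cls := 𝒱.cls) (by simp) hdeg hn4 hlarge hDbig
  -- The two remaining labels, found by a finite check over the four classes.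
  obtain ⟨c, d, hac, hcover⟩ : ∃ c d, a ≠ c ∧ ∀ x, x = a ∨ x = b ∨ x = c ∨ x = d := by
    clear hlink
    revert a b
    decide
  have h3 : ∀ c, 3 ≤ (𝒱.cls ⁻¹' {c}).ncard := fun c => by
    have := hlarge c
    omega
  obtain ⟨e, T, hT⟩ :=
    hconn.isTriplyLinked.exists_hasTrailIn hac (h3 a) (h3 c) (h3 d) hlink
  have : Nonempty V := Fintype.card_pos_iff.1 (hV ▸ hn)
  obtain ⟨P, hP⟩ := (hT.mono (W' := Set.univ) (fun x _ => hcover x)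
    (show 10 ≤ 33 by norm_num)).exists_isTour
  refine ⟨P, ?_⟩
  rw [hV] at hP
  exact_mod_cast hP
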